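/- A server with a library of $N$ files of unit size broadcasts, at a rate of one file per unit of time, to users who are each connected to exactly one of $\Lambda$ caches. If $L=(L_1,\dots,L_\Lambda)$ is the vector of occupancies ($L_\lambda$ users are connected to cache $\lambda$), there are $K=\sum_\lambda L_\lambda$ users, and $N\ge K$. An uncoded placement splits every file into equally long packets and chooses for every packet the set of caches that store it; it is regular with redundancy $t$ if every packet is stored in exactly $t$ caches. For an uncoded placement $\mathcal Z$, a demand vector $d\in[N]^K$ and occupancies $L$, let $T^*(\mathcal Z,d,L)$ be the infimum, over all packet lengths of $B\ge 1$ bits and over all delivery schemes, of the broadcast time (the number of broadcast bits divided by the number of bits in a file), where a delivery scheme encodes the library into the broadcast bits so that every user recovers its requested file without error from these bits and the content of its cache. Let $0\le t\le\Lambda$ be an integer, let $\bar L=(\bar L_1,\dots,\bar L_\Lambda)$ be a vector of positive integers, and let $e_k$ be the $k$-th elementary symmetric function. The placement $\mathcal Z^*_{\bar L}$ with redundancy $t$ designed for $\bar L$ splits every file into $e_t(\bar L)$ packets of equal length, indexed by the pairs $(\tau,m)$ with $\tau\subseteq[\Lambda]$, $|\tau|=t$ and $1\le m\le\prod_{\lambda\in\tau}\bar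 L_\lambda$, and stores packet $(\tau,m)$ of each file in exactly the caches in $\tau$. Let $T^*(t,L,\bar L)=\max_{d}T^*(\mathcal Z^*_{\bar L},d,L)$ and $T(t,\bar L)=e_{t+1}(\bar L)/e_t(\bar L)$. Let $\mathcal L_1,\dots,\mathcal L_\Lambda$ be independent random variables with values in the nonnegative integers and with $\mathbb E[\mathcal L_\lambda]=\bar L_\lambda$ for all $\lambda$. Then, for any library size $N$ (which may be random) with $N\ge\sum_\lambda\mathcal L_\lambda$ almost surely, $$\mathbb E_{\mathcal L}\big[T^*(t,\mathcal L,\bar L)\big]\;\ge\;T(t,\bar L)=\frac{e_{t+1}(\bar L)}{e_t(\bar L)} .$$ Moreover, if $N$ is a constant with $N\ge\sum_\lambda\mathcal L_\lambda$ almost surely, the same bound holds when $\mathcal Z^*_{\bar L}$ is replaced by any placement $\mathcal Z$ that minimizes $\max_d T^*(\mathcal Z,d,\bar L)$ among all regular uncoded placements with redundancy $t$. -/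

import Mathlib

open MeasureTheory ProbabilityTheory
open scoped ENNReal

namespace SharedCache

/-- The `k`-th elementary symmetric function of the entries of the vector `x`. -/
def elemSymm {Λ : ℕ} (x : Fin Λ → ℕ) (k : ℕ) : ℕ :=
  (Finset.univ.val.map x).esymm k

/-- The users of a network with `Λ` caches in which `l c` users are connected to cache `c`:
the pair `⟨c, i⟩` is the `i`-th user of cache `c`, so there are `∑ c, l c` users. -/
abbrev User {Λ : ℕ} (l : Fin Λ → ℕ) : Type := (c : Fin Λ) × Fin (l c)

/-- An uncoded placement of `N` files in `Λ` caches. Every file is split into equally long packets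
indexed by the finite type `P`, and `Z n p` is the set of the caches that store packet `p` of
file `n`. The content of the caches, and hence the memory allocation, is determined by `Z`. -/
abbrev Placement (Λ N : ℕ) (P : Type) : Type := Fin N → P → Finset (Fin Λ)

/-- The content of a library of `N` files when every packet consists of `B` bits. -/
abbrev Library (N : ℕ) (P : Type) (B : ℕ) : Type := Fin N → P → Fin B → Bool

/-- The content of cache `c`: all the packets that are placed in it. -/
def cacheContent {Λ N B : ℕ} {P : Type} (Z : Placement Λ N P) (W : Library N P B) (c : Fin Λ) :
    {x : Fin N × P // c ∈ Z x.1 x.2} → Fin B → Bool :=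
  fun x => W x.1.1 x.1.2

/-- With packets of `B` bits, `R` broadcast bits suffice to serve the demand `d`: some encoder
(which sees the whole library) and some decoders (one for each user, which see the broadcast bits
and the content of the user's cache) let every user recover its requested file without error,
whatever the content of the library is. -/
def Deliverable {Λ N : ℕ} {P : Type} {l : Fin Λ → ℕ} (Z : Placement Λ N P)
    (d : User l → Fin N) (B R : ℕ) : Prop :=
  ∃ (encode : Library N P B → (Fin R → Bool))
    (decode : (u : User l) → (Fin R → Bool) →
      ({x : Fin N × P // u.1 ∈ Z x.1 x.2} → Fin B → Bool) → (P → Fin B → Bool)),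
    ∀ (W : Library N P B) (u : User l),
      decode u (encode W) (cacheContent Z W u.1) = W (d u)

/-- The minimum delivery time for the placement `Z` and the demand `d`, over all delivery schemes
and all packet lengths. The channel carries one file, that is `card P * B` bits, per unit of
time. -/
noncomputable def deliveryTime {Λ N : ℕ} {P : Type} [Fintype P] {l : Fin Λ → ℕ}
    (Z : Placement Λ N P) (d : User l → Fin N) : ℝ≥0∞ :=
  ⨅ (B : ℕ) (R : ℕ) (_ : 0 < B) (_ : Deliverable Z d B R),
    (R : ℝ≥0∞) / ((Fintype.card P : ℝ≥0∞) * (B : ℝ≥0∞))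

/-- The worst-case delivery time of the placement `Z` over all demands, when the occupancies of the
caches are `l`. -/
noncomputable def worstCaseTime {Λ N : ℕ} {P : Type} [Fintype P]
    (Z : Placement Λ N P) (l : Fin Λ → ℕ) : ℝ≥0∞ :=
  ⨆ d : User l → Fin N, deliveryTime Z d

/-- The placement is regular with redundancy `t`: everything in the library is stored in exactly
`t` caches. In particular the total size of the caches is `t` times that of the library. -/
def IsRegular {Λ N : ℕ} {P : Type} (t : ℕ) (Z : Placement Λ N P) : Prop :=
  ∀ n p, (Z n p).card = t

/-- `Z` is an optimal placement for the occupancies `l` among all the regular uncoded placements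
with redundancy `t`: it minimizes the worst-case delivery time. -/
def IsOptimalPlacement {Λ N : ℕ} {P : Type} [Fintype P] (t : ℕ) (l : Fin Λ → ℕ)
    (Z : Placement Λ N P) : Prop :=
  IsRegular t Z ∧
    ∀ (P' : Type) [Fintype P'] [Nonempty P'] (Z' : Placement Λ N P'), IsRegular t Z' →
      worstCaseTime Z l ≤ worstCaseTime Z' l

/-- The packets of a file in the placement designed for the occupancies `l`: the packets `(τ, m)`,
where `τ` is a set of `t` caches and `m` takes `∏ c ∈ τ, l c` values. -/
abbrev DesignedPacket {Λ : ℕ} (t : ℕ) (l : Fin Λ → ℕ) : Type :=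
  (τ : {τ : Finset (Fin Λ) // τ.card = t}) × Fin (∏ c ∈ τ.1, l c)

/-- The placement with redundancy `t` that is designed for the occupancies `l`: packet `(τ, m)` of
each file is stored in exactly the caches in `τ`. -/
def designedPlacement {Λ : ℕ} (N t : ℕ) (l : Fin Λ → ℕ) : Placement Λ N (DesignedPacket t l) :=
  fun _ p => p.1.1

/-- The optimal worst-case delivery time, for a library of `N` files, when the placement is designed
for the occupancies `lbar` and the actual occupancies are `l`. -/
noncomputable def optimalTime {Λ : ℕ} (N t : ℕ) (l lbar : Fin Λ → ℕ) : ℝ≥0∞ :=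
  worstCaseTime (designedPlacement N t lbar) l

/-- The optimal delivery time `e_{t+1}(l) / e_t(l)` when the occupancies `l` are known to the
placement. -/
noncomputable def topologyAwareTime {Λ : ℕ} (t : ℕ) (l : Fin Λ → ℕ) : ℝ≥0∞ :=
  (elemSymm l (t + 1) : ℝ≥0∞) / (elemSymm l t : ℝ≥0∞)

end SharedCache

namespace SharedCache

/-! For a fixed order of the caches and distinct demands, the acyclic bound
(`Deliverable.card_mul_le`) counts the requested packets stored only in caches after the requesting
user's cache. Once this count no longer depends on which files are requested, it is linear in the
occupancies with deterministic coefficients, so taking the mean replaces the random occupancies by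
`Lbar`.

It remains to find one order that is good for `Lbar` (`exists_rank_le`). Draw a `t`-set `A` with
weight `∏ a ∈ A, l a`, put it last and shuffle the other caches uniformly. The expected count per
packet is then at least `e_{t+1} / e_t`, whatever `t`-set stores the packet, so some order attains
this on average over the packets. -/

theorem elemSymm_eq_sum {Λ : ℕ} (x : Fin Λ → ℕ) (k : ℕ) :
    elemSymm x k = ∑ S ∈ Finset.univ.powersetCard k, ∏ c ∈ S, x c :=
  Finset.esymm_map_val x Finset.univ k

/-! ### Combinatorics: a good order of the caches -/

/-- Among the permutations of a finite linear order, the fraction of those that put `c` before all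
the elements of `S` is `1 / (#S + 1)`. -/
theorem card_perm_lt_mul {Λ : ℕ} (S : Finset (Fin Λ)) (c : Fin Λ) (hc : c ∉ S) :
    (Finset.univ.filter fun σ : Equiv.Perm (Fin Λ) => ∀ x ∈ S, σ c < σ x).card * (S.card + 1) =
      Nat.factorial Λ := by
  classical
  set T := insert c S with hT
  -- The classes `F b`, according to which `b ∈ T` comes first, partition the permutations;
  -- transpositions show that they have equal size.
  let F : Fin Λ → Finset (Equiv.Perm (Fin Λ)) := fun b =>
    Finset.univ.filter fun σ => ∀ x ∈ T, σ b ≤ σ x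
  have hF : (Finset.univ.filter fun σ : Equiv.Perm (Fin Λ) => ∀ x ∈ S, σ c < σ x) = F c := by
    ext σ
    simp only [F, hT, Finset.mem_filter, Finset.mem_univ, true_and, Finset.mem_insert,
      forall_eq_or_imp, le_refl]
    refine forall₂_congr fun x hx => ?_
    have : σ c ≠ σ x := fun h => hc (σ.injective h ▸ hx)
    exact ⟨le_of_lt, fun h => lt_of_le_of_ne h this⟩
  have hcard : ∀ b ∈ T, (F b).card = (F c).card := by
    intro b hb
    have hsw : ∀ x, x ∈ T → Equiv.swap b c x ∈ T := by
      intro x hx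
      rw [Equiv.swap_apply_def]
      split_ifs
      exacts [by simp [hT], hb, hx]
    refine Finset.card_equiv (Equiv.mulRight (Equiv.swap b c)) fun σ => ?_
    simp only [F, Finset.mem_filter, Finset.mem_univ, true_and, Equiv.coe_mulRight,
      Equiv.Perm.mul_apply, Equiv.swap_apply_right]
    exact ⟨fun h x hx => h _ (hsw x hx), fun h x hx => by simpa using h _ (hsw x hx)⟩
  have hdisj : (T : Set (Fin Λ)).PairwiseDisjoint F := by
    intro a ha b hb hab
    refine Finset.disjoint_left.2 fun σ h1 h2 => hab ?_
    simp only [F, Finset.mem_filter, Finset.mem_univ, true_and] at h1 h2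
    exact σ.injective (le_antisymm (h1 b hb) (h2 a ha))
  have hunion : T.biUnion F = Finset.univ := by
    refine Finset.eq_univ_iff_forall.2 fun σ => ?_
    obtain ⟨b, hb, hmin⟩ := T.exists_min_image σ ⟨c, by simp [hT]⟩
    exact Finset.mem_biUnion.2 ⟨b, hb, by simpa [F] using hmin⟩
  have h := Finset.card_biUnion hdisj
  rw [hunion, Finset.sum_congr rfl hcard, Finset.sum_const, Finset.card_univ, Fintype.card_perm,
    Fintype.card_fin, hT, Finset.card_insert_of_notMem hc, smul_eq_mul] at h
  rw [hF, h, mul_comm]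

/-- The order in which the caches outside `A` come first, permuted by `σ`. -/
def rankLast {Λ : ℕ} (A : Finset (Fin Λ)) (σ : Equiv.Perm (Fin Λ)) (c : Fin Λ) : ℕ :=
  if c ∈ A then Λ else σ c

/-- The elements of `τ ∩ A` come after `c` automatically, so `c` competes only with `τ \ A`. -/
theorem factorial_le_card_rankLast {Λ : ℕ} (A τ : Finset (Fin Λ)) (c : Fin Λ) (hA : c ∉ A)
    (hτ : c ∉ τ) :
    Nat.factorial Λ ≤
      (Finset.univ.filter fun σ : Equiv.Perm (Fin Λ) =>
        ∀ x ∈ τ, rankLast A σ c < rankLast A σ x).card * ((τ \ A).card + 1) := by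
  rw [← card_perm_lt_mul (τ \ A) c (by simp [hτ])]
  refine Nat.mul_le_mul_right _ (Finset.card_le_card fun σ => ?_)
  simp only [Finset.mem_filter, Finset.mem_univ, true_and]
  intro h x hx
  unfold rankLast
  rw [if_neg hA]
  split_ifs with hxA
  · exact (σ c).2
  · exact h x (by simp [hx, hxA])

/-- Spread the monomial of each `(t+1)`-set `S` evenly over the `#(τ \ S) + 1` elements `c` of `S \
τ`, and write `S = A ∪ {c}`; then `τ \ A = τ \ S` because `c ∉ τ`. -/
theorem elemSymm_succ_eq_sum {Λ t : ℕ} (l : Fin Λ → ℕ) (τ : Finset (Fin Λ)) (hτ : τ.card = t) :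
    (elemSymm l (t + 1) : ℚ) = ∑ A ∈ Finset.univ.powersetCard t,
      ∑ c ∈ Finset.univ.filter (fun c => c ∉ A ∧ c ∉ τ),
        (∏ a ∈ A, (l a : ℚ)) * l c / ((τ \ A).card + 1) := by
  classical
  have h1 : (elemSymm l (t + 1) : ℚ) = ∑ S ∈ Finset.univ.powersetCard (t + 1),
      ∑ c ∈ S \ τ, (∏ a ∈ S, (l a : ℚ)) / ((τ \ S).card + 1) := by
    rw [elemSymm_eq_sum]
    push_cast
    refine Finset.sum_congr rfl fun S hS => ?_
    rw [Finset.sum_const, nsmul_eq_mul]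
    have hS' := (Finset.mem_powersetCard.1 hS).2
    have : (S \ τ).card = (τ \ S).card + 1 := by
      have e1 := Finset.card_sdiff_add_card_inter S τ
      have e2 := Finset.card_sdiff_add_card_inter τ S
      rw [Finset.inter_comm] at e2
      omega
    rw [this]
    push_cast
    field_simp
  rw [h1, Finset.sum_sigma', Finset.sum_sigma']
  refine Finset.sum_bij' (fun x _ => ⟨x.1.erase x.2, x.2⟩) (fun x _ => ⟨insert x.2 x.1, x.2⟩)
    ?_ ?_ ?_ ?_ ?_
  · rintro ⟨S, c⟩ h
    simp only [Finset.mem_sigma, Finset.mem_powersetCard, Finset.subset_univ, true_and,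
      Finset.mem_sdiff] at h
    simp [Finset.card_erase_of_mem h.2.1, h.1, h.2.2]
  · rintro ⟨A, c⟩ h
    simp only [Finset.mem_sigma, Finset.mem_powersetCard, Finset.subset_univ, true_and,
      Finset.mem_filter, Finset.mem_univ] at h
    simp [Finset.card_insert_of_notMem h.2.1, h.1, h.2.2]
  · rintro ⟨S, c⟩ h
    simp only [Finset.mem_sigma, Finset.mem_sdiff] at h
    simp [Finset.insert_erase h.2.1]
  · rintro ⟨A, c⟩ h
    simp only [Finset.mem_sigma, Finset.mem_filter] at h
    simp [Finset.erase_insert h.2.2.1]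
  · rintro ⟨S, c⟩ h
    simp only [Finset.mem_sigma, Finset.mem_sdiff] at h
    have : τ \ S.erase c = τ \ S := by
      ext x
      simp only [Finset.mem_sdiff, Finset.mem_erase, not_and]
      refine and_congr_right fun hx => ⟨fun h' => h' ?_, fun h' _ => h'⟩
      rintro rfl
      exact h.2.2 hx
    simp only [this, Finset.prod_erase_mul _ _ h.2.1]

/-- For every family of sets of `t` caches there is an order of the caches in which the number of
pairs of a user and a set all of whose elements come after the user's cache is at least as large
as for the family of the designed placement. -/
theorem exists_rank_le {Λ t : ℕ} (l : Fin Λ → ℕ) {P : Type*} [Fintype P]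
    (m : P → Finset (Fin Λ)) (hm : ∀ p, (m p).card = t) (het : 0 < elemSymm l t) :
    ∃ r : Fin Λ → ℕ, Fintype.card P * elemSymm l (t + 1) ≤
      elemSymm l t * ∑ c, l c * (Finset.univ.filter fun p => ∀ x ∈ m p, r c < r x).card := by
  classical
  by_contra! hcon
  set F : (Fin Λ → ℕ) → ℕ := fun r =>
    ∑ c, l c * (Finset.univ.filter fun p => ∀ x ∈ m p, r c < r x).card with hF
  let X := Finset.powersetCard t (Finset.univ : Finset (Fin Λ))
  have hFp : ∀ r, (F r : ℚ) = ∑ p, ∑ c, if ∀ x ∈ m p, r c < r x then (l c : ℚ) else 0 := by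
    intro r
    rw [Finset.sum_comm]
    simp only [hF, Nat.cast_sum, Nat.cast_mul]
    refine Finset.sum_congr rfl fun c _ => ?_
    rw [← Finset.sum_filter, Finset.sum_const, nsmul_eq_mul, mul_comm]
  -- The average over `(A, σ)` is bounded below packet by packet; caches in `A` or in the packet's
  -- own set are dropped.
  have hlow : (Nat.factorial Λ : ℚ) * Fintype.card P * elemSymm l (t + 1) ≤
      ∑ A ∈ X, ∑ σ : Equiv.Perm (Fin Λ), (∏ a ∈ A, (l a : ℚ)) * F (rankLast A σ) := by
    have : ∀ p, (Nat.factorial Λ : ℚ) * elemSymm l (t + 1) ≤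
        ∑ A ∈ X, ∑ σ : Equiv.Perm (Fin Λ), (∏ a ∈ A, (l a : ℚ)) *
          ∑ c, if ∀ x ∈ m p, rankLast A σ c < rankLast A σ x then (l c : ℚ) else 0 := by
      intro p
      rw [elemSymm_succ_eq_sum l (m p) (hm p), Finset.mul_sum]
      refine Finset.sum_le_sum fun A _ => ?_
      rw [← Finset.mul_sum, Finset.sum_comm, Finset.mul_sum, Finset.mul_sum]
      refine (Finset.sum_le_sum fun c hc => ?_).trans
        (Finset.sum_le_sum_of_subset_of_nonneg (Finset.subset_univ _) fun c _ _ => by positivity)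
      obtain ⟨-, hcA, hcm⟩ := Finset.mem_filter.1 hc
      rw [← Finset.sum_filter, Finset.sum_const, nsmul_eq_mul]
      have h := factorial_le_card_rankLast A (m p) c hcA hcm
      have h' : (Nat.factorial Λ : ℚ) ≤ ((Finset.univ.filter fun σ : Equiv.Perm (Fin Λ) =>
        ∀ x ∈ m p, rankLast A σ c < rankLast A σ x).card : ℚ) * ((m p \ A).card + 1) := by
        exact_mod_cast h
      rw [← mul_div_assoc, div_le_iff₀ (by positivity)]
      calc _ ≤ (((Finset.univ.filter fun σ : Equiv.Perm (Fin Λ) =>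
        ∀ x ∈ m p, rankLast A σ c < rankLast A σ x).card : ℚ) * ((m p \ A).card + 1)) *
            ((∏ a ∈ A, (l a : ℚ)) * l c) := by gcongr
        _ = _ := by ring
    have hs := Finset.sum_le_sum fun p (_ : p ∈ (Finset.univ : Finset P)) => this p
    rw [Finset.sum_const, Finset.card_univ, nsmul_eq_mul, Finset.sum_comm] at hs
    calc _ = (Fintype.card P : ℚ) * (Nat.factorial Λ * elemSymm l (t + 1)) := by ring
      _ ≤ _ := hs
      _ = _ := by
        refine Finset.sum_congr rfl fun A _ => ?_
        rw [Finset.sum_comm]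
        refine Finset.sum_congr rfl fun σ _ => ?_
        rw [hFp, Finset.mul_sum]
  have hpos : (0 : ℚ) < elemSymm l t := by exact_mod_cast het
  have he : (elemSymm l t : ℚ) = ∑ A ∈ X, ∏ a ∈ A, (l a : ℚ) := by
    rw [elemSymm_eq_sum]
    push_cast
    rfl
  have hup : ∑ A ∈ X, ∑ σ : Equiv.Perm (Fin Λ), (∏ a ∈ A, (l a : ℚ)) * F (rankLast A σ) <
      ∑ A ∈ X, ∑ _σ : Equiv.Perm (Fin Λ), (∏ a ∈ A, (l a : ℚ)) *
        (Fintype.card P * elemSymm l (t + 1) / elemSymm l t) := by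
    have hlt : ∀ r, (F r : ℚ) < Fintype.card P * elemSymm l (t + 1) / elemSymm l t := by
      intro r
      rw [lt_div_iff₀ hpos, mul_comm]
      exact_mod_cast hcon r
    -- Entries of `l` may vanish, so strictness needs a set of nonzero weight.
    obtain ⟨A, hA, hA0⟩ : ∃ A ∈ X, (∏ a ∈ A, (l a : ℚ)) ≠ 0 := by
      by_contra! h
      exact hpos.ne' (he.trans (Finset.sum_eq_zero h))
    refine Finset.sum_lt_sum (fun A _ => Finset.sum_le_sum fun σ _ =>
      mul_le_mul_of_nonneg_left (hlt _).le (by positivity)) ⟨A, hA, ?_⟩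
    refine Finset.sum_lt_sum_of_nonempty Finset.univ_nonempty fun σ _ =>
      mul_lt_mul_of_pos_left (hlt _) (lt_of_le_of_ne (by positivity) hA0.symm)
  have heq : ∑ A ∈ X, ∑ _σ : Equiv.Perm (Fin Λ), (∏ a ∈ A, (l a : ℚ)) *
        (Fintype.card P * elemSymm l (t + 1) / elemSymm l t) =
      Nat.factorial Λ * Fintype.card P * elemSymm l (t + 1) := by
    simp only [Finset.sum_const, Finset.card_univ, Fintype.card_perm, Fintype.card_fin,
      nsmul_eq_mul]
    rw [← Finset.mul_sum, ← Finset.sum_mul, ← he]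
    field_simp
  exact absurd (hlow.trans_lt (hup.trans_eq heq)) (lt_irrefl _)

/-! ### Converse bounds on the delivery time -/

/-- The acyclic (genie-aided) bound: for distinct demands and for every order of the caches, the
server has to send all the packets of the requested files that are stored only in caches that come
after the cache of the user who requests them. -/
theorem Deliverable.card_mul_le {Λ N : ℕ} {P : Type} [Fintype P] {l : Fin Λ → ℕ}
    {Z : Placement Λ N P} {d : User l → Fin N} (hd : Function.Injective d) {B R : ℕ}
    (h : Deliverable Z d B R) (r : Fin Λ → ℕ) :
    (∑ u : User l, (Finset.univ.filter fun p => ∀ x ∈ Z (d u) p, r u.1 < r x).card) * B ≤ R := by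
  classical
  obtain ⟨encode, decode, hdec⟩ := h
  let Q : Type := (u : User l) × {p : P // ∀ x ∈ Z (d u) p, r u.1 < r x}
  -- Only the packets counted by the bound are free; all others are fixed to zero.
  let lib : (Q → Fin B → Bool) → Library N P B := fun w n p =>
    if h : ∃ u, d u = n ∧ ∀ x ∈ Z (d u) p, r u.1 < r x then
      w ⟨h.choose, p, h.choose_spec.2⟩ else fun _ => false
  have hlib : ∀ w (q : Q), lib w (d q.1) q.2.1 = w q := by
    rintro w ⟨u, p, hp⟩
    have hex : ∃ v, d v = d u ∧ ∀ x ∈ Z (d v) p, r v.1 < r x := ⟨u, rfl, hp⟩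
    have hu : hex.choose = u := hd hex.choose_spec.1
    simp only [lib, dif_pos hex]
    congr 1
    ext1
    · exact hu
    · rfl
  -- Induction on the rank: a free packet in the cache of `u` was requested by a user of smaller
  -- rank, so its value is already determined by the broadcast.
  have key : ∀ w w', encode (lib w) = encode (lib w') → ∀ k, ∀ u : User l, r u.1 = k →
      lib w (d u) = lib w' (d u) := by
    intro w w' he k
    induction k using Nat.strong_induction_on with
    | _ k ih =>
      intro u hu
      rw [← hdec (lib w) u, ← hdec (lib w') u, he]
      congr 1
      funext ⟨⟨n, p⟩, hx⟩
      simp only [cacheContent]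
      by_cases hex : ∃ v, d v = n ∧ ∀ x ∈ Z (d v) p, r v.1 < r x
      · obtain ⟨v, rfl, hv⟩ := hex
        exact congrFun (ih (r v.1) (hu ▸ hv _ hx) v rfl) p
      · simp only [lib, dif_neg hex]
  have hinj : Function.Injective fun w => encode (lib w) := by
    intro w w' he
    funext q
    rw [← hlib w q, ← hlib w' q, key w w' he _ q.1 rfl]
  have hc := Fintype.card_le_of_injective _ hinj
  simp only [Fintype.card_fun, Fintype.card_bool, Fintype.card_fin, ← pow_mul] at hc
  have := (Nat.pow_le_pow_iff_right (by norm_num : 1 < 2)).1 hc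
  rw [mul_comm, Fintype.card_sigma] at this
  simpa only [Fintype.card_subtype] using this

theorem natCast_div_le_div {a b c d : ℕ} (hb : b ≠ 0) (hd : d ≠ 0) (h : a * d ≤ c * b) :
    (a : ℝ≥0∞) / b ≤ c / d := by
  have hb' : (b : ℝ≥0∞) ≠ 0 := by exact_mod_cast hb
  have hd' : (d : ℝ≥0∞) ≠ 0 := by exact_mod_cast hd
  rw [ENNReal.div_le_iff hb' (ENNReal.natCast_ne_top b), mul_comm, ← mul_div_assoc,
    ENNReal.le_div_iff_mul_le (Or.inl hd') (Or.inl (ENNReal.natCast_ne_top d)), mul_comm (b : ℝ≥0∞)]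
  exact_mod_cast h

theorem le_worstCaseTime {Λ N : ℕ} {P : Type} [Fintype P] [Nonempty P] {l : Fin Λ → ℕ}
    (Z : Placement Λ N P) {d : User l → Fin N} (hd : Function.Injective d) (r : Fin Λ → ℕ) :
    ((∑ u : User l, (Finset.univ.filter fun p => ∀ x ∈ Z (d u) p, r u.1 < r x).card : ℕ) : ℝ≥0∞)
      / Fintype.card P ≤ worstCaseTime Z l := by
  refine le_trans ?_ (le_iSup _ d)
  refine le_iInf fun B => le_iInf fun R => le_iInf fun hB => le_iInf fun h => ?_
  have hle := h.card_mul_le hd r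
  have hB0 : (B : ℝ≥0∞) ≠ 0 := by exact_mod_cast hB.ne'
  rw [← ENNReal.mul_div_mul_right _ _ hB0 (ENNReal.natCast_ne_top B)]
  gcongr
  exact_mod_cast hle

/-- The bound for any placement, averaged over the files: it is linear in the occupancies. -/
theorem sum_div_le_worstCaseTime {Λ N : ℕ} [NeZero N] {P : Type} [Fintype P] [Nonempty P]
    {l : Fin Λ → ℕ} (Z : Placement Λ N P) (hN : ∑ c, l c ≤ N) (r : Fin Λ → ℕ) :
    ((∑ c, l c * (Finset.univ.filter fun x : Fin N × P =>
        ∀ y ∈ Z x.1 x.2, r c < r y).card : ℕ) : ℝ≥0∞)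
      / Fintype.card (Fin N × P) ≤ worstCaseTime Z l := by
  classical
  obtain ⟨e⟩ : Nonempty (User l ↪ Fin N) :=
    Function.Embedding.nonempty_of_card_le (by simpa using hN)
  let q : Fin Λ → Fin N → ℕ := fun c n => (Finset.univ.filter fun p => ∀ x ∈ Z n p, r c < r x).card
  have hq : ∀ c, (Finset.univ.filter fun x : Fin N × P => ∀ y ∈ Z x.1 x.2, r c < r y).card =
      ∑ n, q c n := by
    intro c
    simp only [q, Finset.card_filter, Fintype.sum_prod_type]
  -- Over all cyclic shifts of the demand, each user requests every file exactly once; some shift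
  -- does at least as well as the average.
  have hsum : ∑ s : Fin N, ∑ u : User l, q u.1 (e u + s) = ∑ c, l c * ∑ n, q c n := by
    rw [Finset.sum_comm, Fintype.sum_sigma]
    refine Finset.sum_congr rfl fun c _ => ?_
    have : ∀ i : Fin (l c), ∑ s : Fin N, q c (e ⟨c, i⟩ + s) = ∑ n, q c n := fun i =>
      Equiv.sum_comp (Equiv.addLeft (e ⟨c, i⟩)) (q c)
    simp [this]
  obtain ⟨s, -, hs⟩ : ∃ s ∈ (Finset.univ : Finset (Fin N)),
      ∑ c, l c * ∑ n, q c n ≤ N * ∑ u : User l, q u.1 (e u + s) := by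
    refine Finset.exists_le_of_sum_le (f := fun _ => ∑ c, l c * ∑ n, q c n) Finset.univ_nonempty ?_
    rw [← Finset.mul_sum, hsum]
    simp
  have hb := le_worstCaseTime Z (d := fun u => e u + s)
    (fun u v h => e.injective (add_right_cancel h)) r
  refine le_trans ?_ hb
  simp only [hq]
  refine natCast_div_le_div Fintype.card_ne_zero Fintype.card_ne_zero ?_
  rw [Fintype.card_prod, Fintype.card_fin, ← mul_assoc, mul_comm _ N]
  exact Nat.mul_le_mul_right _ hs

/-- All files are placed alike, so no averaging over files is needed and the coefficients do not
involve `N`; this allows a random library size. -/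
theorem sum_div_le_optimalTime {Λ N t : ℕ} {l lbar : Fin Λ → ℕ} [Nonempty (DesignedPacket t lbar)]
    (hN : ∑ c, l c ≤ N) (r : Fin Λ → ℕ) :
    ((∑ c, l c * (Finset.univ.filter fun p : DesignedPacket t lbar =>
        ∀ y ∈ p.1.1, r c < r y).card : ℕ) : ℝ≥0∞)
      / Fintype.card (DesignedPacket t lbar) ≤ optimalTime N t l lbar := by
  obtain ⟨e⟩ : Nonempty (User l ↪ Fin N) :=
    Function.Embedding.nonempty_of_card_le (by simpa using hN)
  have h := le_worstCaseTime (designedPlacement N t lbar) e.injective r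
  refine le_of_eq_of_le ?_ h
  rw [Fintype.sum_sigma]
  congr 2
  refine Finset.sum_congr rfl fun c _ => Eq.symm
    ((Finset.sum_const (s := (Finset.univ : Finset (Fin (l c)))) (Finset.univ.filter
      fun p : DesignedPacket t lbar => ∀ y ∈ p.1.1, r c < r y).card).trans ?_)
  rw [Finset.card_univ, Fintype.card_fin, smul_eq_mul]

theorem elemSymm_pos {Λ t : ℕ} (ht : t ≤ Λ) {l : Fin Λ → ℕ} (hl : ∀ c, 0 < l c) :
    0 < elemSymm l t := by
  rw [elemSymm_eq_sum]
  refine Finset.sum_pos (fun S _ => Finset.prod_pos fun c _ => hl c) ?_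
  exact Finset.powersetCard_nonempty.2 (by simpa using ht)

theorem nonempty_designedPacket {Λ t : ℕ} (ht : t ≤ Λ) {l : Fin Λ → ℕ} (hl : ∀ c, 0 < l c) :
    Nonempty (DesignedPacket t l) := by
  obtain ⟨τ, -, hτ⟩ := Finset.exists_subset_card_eq (s := (Finset.univ : Finset (Fin Λ)))
    (by simpa using ht)
  exact ⟨⟨τ, hτ⟩, ⟨0, Finset.prod_pos fun c _ => hl c⟩⟩

/-! ### Taking the mean -/

/-- A bound on the delivery time that is linear in the occupancies, and that comes from a family of
sets of `t` caches and a good order of the caches, survives taking the mean. -/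
theorem topologyAwareTime_le_lintegral {Ω : Type*} [MeasurableSpace Ω] {μ : Measure Ω}
    {Λ t : ℕ} {Lbar : Fin Λ → ℕ} (het : 0 < elemSymm Lbar t)
    {L : Fin Λ → Ω → ℕ} (hL : ∀ c, Measurable (L c))
    (hint : ∀ c, Integrable (fun ω => (L c ω : ℝ)) μ)
    (hmean : ∀ c, ∫ ω, (L c ω : ℝ) ∂μ = (Lbar c : ℝ))
    {P : Type*} [Fintype P] [Nonempty P] (m : P → Finset (Fin Λ)) (hm : ∀ p, (m p).card = t)
    {T : Ω → ℝ≥0∞}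
    (hT : ∀ r : Fin Λ → ℕ, ∀ᵐ ω ∂μ, ((∑ c, L c ω * (Finset.univ.filter fun p =>
      ∀ y ∈ m p, r c < r y).card : ℕ) : ℝ≥0∞) / Fintype.card P ≤ T ω) :
    topologyAwareTime t Lbar ≤ ∫⁻ ω, T ω ∂μ := by
  -- The order is chosen for the mean occupancies, hence is the same for all `ω`.
  obtain ⟨r, hr⟩ := exists_rank_le Lbar m hm het
  have hlint : ∀ c, ∫⁻ ω, (L c ω : ℝ≥0∞) ∂μ = Lbar c := by
    intro c
    have h := ofReal_integral_eq_lintegral_ofReal (hint c) (ae_of_all _ fun ω => by positivity)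
    rw [hmean c] at h
    simpa using h.symm
  have hmeas : ∀ c, Measurable fun ω => (L c ω : ℝ≥0∞) := fun c =>
    (measurable_from_top (f := fun n : ℕ => (n : ℝ≥0∞))).comp (hL c)
  refine le_trans ?_ (lintegral_mono_ae (hT r))
  simp only [div_eq_mul_inv, Nat.cast_sum, Nat.cast_mul]
  rw [lintegral_mul_const _ (Finset.measurable_sum _ fun c _ => (hmeas c).mul_const _),
    lintegral_finsetSum _ fun c _ => (hmeas c).mul_const _]
  simp only [lintegral_mul_const _ (hmeas _), hlint]
  rw [← div_eq_mul_inv, topologyAwareTime]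
  have h := natCast_div_le_div het.ne' (Fintype.card_ne_zero (α := P))
    (a := elemSymm Lbar (t + 1))
    (c := ∑ c, Lbar c * (Finset.univ.filter fun p => ∀ x ∈ m p, r c < r x).card)
    (by linarith)
  simpa only [Nat.cast_sum, Nat.cast_mul] using h

end SharedCache

theorem proposition4 {Ω : Type*} [MeasurableSpace Ω] (μ : Measure Ω) [IsProbabilityMeasure μ]
    (Λ t : ℕ) (ht : t ≤ Λ)
    (Lbar : Fin Λ → ℕ) (hLbar : ∀ c, 0 < Lbar c)
    (L : Fin Λ → Ω → ℕ) (hL : ∀ c, Measurable (L c)) (hindep : iIndepFun L μ)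
    (hint : ∀ c, Integrable (fun ω => (L c ω : ℝ)) μ)
    (hmean : ∀ c, ∫ ω, (L c ω : ℝ) ∂μ = (Lbar c : ℝ)) :
    -- the designed placement, with a library that has at least as many files as there are users
    (∀ N : Ω → ℕ, Measurable N → (∀ᵐ ω ∂μ, ∑ c, L c ω ≤ N ω) →
      SharedCache.topologyAwareTime t Lbar ≤
        ∫⁻ ω, SharedCache.optimalTime (N ω) t (fun c => L c ω) Lbar ∂μ) ∧
    -- any regular placement that is optimal for the mean occupancies
    (∀ (N : ℕ) (P : Type) [Fintype P] [Nonempty P] (Z : SharedCache.Placement Λ N P),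
      SharedCache.IsOptimalPlacement t Lbar Z → (∀ᵐ ω ∂μ, ∑ c, L c ω ≤ N) →
      SharedCache.topologyAwareTime t Lbar ≤
        ∫⁻ ω, SharedCache.worstCaseTime Z (fun c => L c ω) ∂μ) := by
  have het := SharedCache.elemSymm_pos ht hLbar
  constructor
  · intro N _ hN
    have := SharedCache.nonempty_designedPacket ht hLbar
    refine SharedCache.topologyAwareTime_le_lintegral het hL hint hmean
      (fun p : SharedCache.DesignedPacket t Lbar => p.1.1) (fun p => p.1.2) fun r => ?_
    filter_upwards [hN] with ω hω using SharedCache.sum_div_le_optimalTime hω r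
  · intro N P _ _ Z hZ hN
    -- With an empty library all occupancies vanish almost surely; positive means then force `Λ =
    -- 0`, and the bound is zero.
    rcases Nat.eq_zero_or_pos N with rfl | hpos
    · have hempty : IsEmpty (Fin Λ) := by
        refine ⟨fun c => (hLbar c).ne' ?_⟩
        have h0 : (fun ω => (L c ω : ℝ)) =ᵐ[μ] 0 := by
          filter_upwards [hN] with ω hω
          have := (Finset.single_le_sum (f := fun c => L c ω) (fun _ _ => Nat.zero_le _)
            (Finset.mem_univ c)).trans hω
          simpa using this
        have h := hmean c
        rw [integral_eq_zero_of_ae h0] at h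
        exact_mod_cast h.symm
      have : SharedCache.elemSymm Lbar (t + 1) = 0 := by
        rw [SharedCache.elemSymm_eq_sum, Finset.powersetCard_eq_empty.2 (by simp), Finset.sum_empty]
      simp [SharedCache.topologyAwareTime, this]
    · have : NeZero N := ⟨hpos.ne'⟩
      refine SharedCache.topologyAwareTime_le_lintegral het hL hint hmean
        (fun x : Fin N × P => Z x.1 x.2) (fun x => hZ.1 x.1 x.2) fun r => ?_
      filter_upwards [hN] with ω hω using SharedCache.sum_div_le_worstCaseTime Z hω r
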